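/- Let $a>0$ and let $f:[-a,a]\to\mathbb{R}$ be concave, even, nonnegative and not identically zero. For $x'\in[-\frac1a,\frac1a]$ define $$f^{\ast}(x')=\inf_{x\in[-a,a],\,f(x)\neq 0}\frac{1-x'x}{f(x)}.$$ Then $$\left(\int_{-a}^{a} f(x)^2\,dx\right)\left(\int_{-1/a}^{1/a} f^{\ast}(x')^2\,dx'\right)\ \ge\ \frac43 ,$$ with equality if and only if either $f(x)=f(0)$ for all $x\in(-a,a)$ (if $f$ is continuous on $[-a,a]$, this is the same as $f(x)=f(0)$ for all $x\in[-a,a]$), or $f^{\ast}(x')=\frac1{f(0)}$ for all $x'\in[-\frac1a,\frac1a]$. Moreover, the generating domain of $f^{\ast}$ is the polar of that of $f$: if $D=\{(x,y):-a\le x\le a,\ |y|\le f(x)\}$, then $$\{(x',y'):-\tfrac1a\le x'\le\tfrac1a,\ |y'|\le f^{\ast}(x')\}=\{p\in\mathbb{R}^2:\ p\cdot q\le 1\ \text{for all } q\in D\}.$$ -/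

import Mathlib

open Set

/-- The dual function `f*(x') = inf (1 - x' x) / f x`, the infimum being over the points `x` of
`[-a, a]`. A point where `f` vanishes puts no constraint on `f*` (the quotient there is `+∞`;
equivalently, `f*(x')` is the largest `y` with `y * f x ≤ 1 - x' x` for all `x ∈ [-a, a]`), so such
points are left out of the infimum. -/
noncomputable def dualFunction (a : ℝ) (f : ℝ → ℝ) (x' : ℝ) : ℝ :=
  sInf ((fun x : ℝ => (1 - x' * x) / f x) '' {x : ℝ | x ∈ Icc (-a) a ∧ f x ≠ 0})

/-- The generating domain `{(x, y) : -a ≤ x ≤ a, |y| ≤ f x}` of `f` on `[-a, a]`. -/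
def generatingDomain (a : ℝ) (f : ℝ → ℝ) : Set (EuclideanSpace ℝ (Fin 2)) :=
  {p | p 0 ∈ Icc (-a) a ∧ |p 1| ≤ f (p 0)}

/-- The polar `{x : x · y ≤ 1 for all y ∈ K}` of a set `K` in Euclidean space. -/
def polarBody {n : ℕ} (K : Set (EuclideanSpace ℝ (Fin n))) : Set (EuclideanSpace ℝ (Fin n)) :=
  {x | ∀ y ∈ K, inner ℝ x y ≤ 1}

/-! By evenness and scaling, everything reduces to `g t = f (a t) / f 0` on `[0, 1]` and its dual
`k`; the product becomes `4 F K` with `F = ∫ g²`, `K = ∫ k²`, so the claim is `F K ≥ 1/3`.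

Put `A = ∫ g`. Concavity gives two linear inequalities valid for every `x`: `x + 2 A g x ≤ 3 F`
(`add_mul_le_integral_sq`) and `x + (2 - 2 A) g x ≤ 4 A - 3 F` (`add_mul_le_integral_sub`). Divided
by their right-hand sides, they say that two explicit points lie under the graph of `k`. Since `k`
is concave, it dominates the polygonal line through `(0, 1)`, these two points and `(1, 0)`.
Integrating the square of that line bounds `F K` below by a rational function of `A` and `F` alone,
and `vertex_inequality` shows that this bound is at least `1/3`, strictly unless `A = 1/2` or `A =
1`. Those extreme values of `A` force `g x = 1 - x`, respectively `g = 1` on `[0, 1)`. The polar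
statement is a separate, direct unfolding of the constraints defining the dual function. -/

theorem ConcaveOn.chord_le {s : Set ℝ} {g : ℝ → ℝ} (hg : ConcaveOn ℝ s g) {x y z : ℝ}
    (hx : x ∈ s) (hy : y ∈ s) (hxz : x ≤ z) (hzy : z ≤ y) :
    (y - z) * g x + (z - x) * g y ≤ (y - x) * g z := by
  rcases hxz.eq_or_lt with rfl | hxz
  · simp
  have h : 0 < y - x := by linarith
  have key := hg.2 hx hy (div_nonneg (sub_nonneg.2 hzy) h.le)
    (div_nonneg (sub_nonneg.2 hxz.le) h.le) (by field_simp; ring)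
  have hz : ((y - z) / (y - x)) • x + ((z - x) / (y - x)) • y = z := by
    simp only [smul_eq_mul]; field_simp; ring
  rw [hz] at key
  simp only [smul_eq_mul] at key
  have := mul_le_mul_of_nonneg_left key h.le
  calc _ = (y - x) * ((y - z) / (y - x) * g x + (z - x) / (y - x) * g y) := by field_simp
    _ ≤ _ := this

/-- Reduces each integral estimate below to a pointwise comparison with a quadratic in the rescaled
variable. -/
theorem quadratic_le_integral {φ : ℝ → ℝ} {u v α β γ : ℝ} (huv : u ≤ v)
    (hφ : IntervalIntegrable φ MeasureTheory.volume u v)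
    (h : ∀ t ∈ Icc (0 : ℝ) 1, α + β * t + γ * t ^ 2 ≤ φ (u + (v - u) * t)) :
    (v - u) * (α + β / 2 + γ / 3) ≤ ∫ x in u..v, φ x := by
  rcases huv.eq_or_lt with rfl | huv'
  · simp
  have hd : 0 < v - u := by linarith
  have hI : ∫ x in u..v, (α + β * ((x - u) / (v - u)) + γ * ((x - u) / (v - u)) ^ 2)
      = (v - u) * (α + β / 2 + γ / 3) := by
    have h1 := intervalIntegral.integral_comp_div_sub
      (a := u) (b := v) (fun t : ℝ => α + β * t + γ * t ^ 2) hd.ne' (u / (v - u))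
    have h2 : ∫ t in (0 : ℝ)..1, (α + β * t + γ * t ^ 2) = α + β / 2 + γ / 3 := by
      rw [intervalIntegral.integral_add (by apply Continuous.intervalIntegrable; fun_prop)
          (by apply Continuous.intervalIntegrable; fun_prop),
        intervalIntegral.integral_add (by apply Continuous.intervalIntegrable; fun_prop)
          (by apply Continuous.intervalIntegrable; fun_prop)]
      rw [intervalIntegral.integral_const_mul, intervalIntegral.integral_const_mul, integral_pow,
        integral_id, intervalIntegral.integral_const]
      norm_num
      ring
    have e0 : u / (v - u) - u / (v - u) = 0 := sub_self _
    have e1 : v / (v - u) - u / (v - u) = 1 := by field_simp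
    rw [e0, e1, h2, smul_eq_mul] at h1
    rw [← h1]
    simp only [sub_div]
  rw [← hI]
  apply intervalIntegral.integral_mono_on huv _ hφ
  · intro x hx
    have := h ((x - u) / (v - u))
      ⟨div_nonneg (sub_nonneg.2 hx.1) hd.le, (div_le_one hd).2 (by linarith [hx.2])⟩
    rwa [mul_div_cancel₀ _ hd.ne', add_sub_cancel] at this
  · apply Continuous.intervalIntegrable; fun_prop

/-! ### Profiles and the first linear inequality -/

/-- A concave function on `[0, 1]` with values in `[0, 1]` and value `1` at `0`. -/
structure IsProfile (g : ℝ → ℝ) : Prop where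
  concave : ConcaveOn ℝ (Icc 0 1) g
  zero : g 0 = 1
  nonneg : ∀ x ∈ Icc (0 : ℝ) 1, 0 ≤ g x
  le_one : ∀ x ∈ Icc (0 : ℝ) 1, g x ≤ 1

namespace IsProfile

variable {g : ℝ → ℝ}

theorem antitoneOn (hg : IsProfile g) : AntitoneOn g (Icc 0 1) := by
  intro x hx y hy hxy
  have h := hg.concave.chord_le (left_mem_Icc.2 zero_le_one) hy hx.1 hxy
  rw [hg.zero] at h
  have := hg.le_one y hy
  rcases (hx.1.trans hxy).eq_or_lt with h0 | h0
  · have : x = y := by linarith [hx.1]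
    rw [this]
  · by_contra! hlt
    nlinarith [mul_nonneg (sub_nonneg.2 hxy) (sub_nonneg.2 this)]

theorem one_sub_le (hg : IsProfile g) {x : ℝ} (hx : x ∈ Icc (0 : ℝ) 1) : 1 - x ≤ g x := by
  have h := hg.concave.chord_le (left_mem_Icc.2 zero_le_one) (right_mem_Icc.2 zero_le_one) hx.1 hx.2
  have := hg.nonneg 1 (right_mem_Icc.2 zero_le_one)
  rw [hg.zero] at h
  nlinarith [hx.1]

theorem integrable (hg : IsProfile g) {u v : ℝ} (hu : u ∈ Icc (0 : ℝ) 1) (hv : v ∈ Icc (0 : ℝ) 1) :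
    IntervalIntegrable g MeasureTheory.volume u v :=
  (hg.antitoneOn.mono (uIcc_subset_Icc hu hv)).intervalIntegrable

theorem integrable_sq (hg : IsProfile g) {u v : ℝ} (hu : u ∈ Icc (0 : ℝ) 1)
    (hv : v ∈ Icc (0 : ℝ) 1) :
    IntervalIntegrable (fun x => g x ^ 2) MeasureTheory.volume u v := by
  apply AntitoneOn.intervalIntegrable
  intro x hx y hy hxy
  have hx' := uIcc_subset_Icc hu hv hx
  have hy' := uIcc_subset_Icc hu hv hy
  exact pow_le_pow_left₀ (hg.nonneg y hy') (hg.antitoneOn hx' hy' hxy) 2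

theorem integrable_quadratic (hg : IsProfile g) (p q : ℝ) {u v : ℝ} (hu : u ∈ Icc (0 : ℝ) 1)
    (hv : v ∈ Icc (0 : ℝ) 1) :
    IntervalIntegrable (fun x => p * g x ^ 2 + q * g x) MeasureTheory.volume u v :=
  ((hg.integrable_sq hu hv).const_mul p).add ((hg.integrable hu hv).const_mul q)

theorem integral_quadratic (hg : IsProfile g) (p q : ℝ) :
    ∫ x in (0 : ℝ)..1, (p * g x ^ 2 + q * g x)
      = p * (∫ x in (0 : ℝ)..1, g x ^ 2) + q * ∫ x in (0 : ℝ)..1, g x := by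
  have h0 : (0 : ℝ) ∈ Icc (0 : ℝ) 1 := by simp
  have h1 : (1 : ℝ) ∈ Icc (0 : ℝ) 1 := by simp
  rw [intervalIntegral.integral_add ((hg.integrable_sq h0 h1).const_mul p)
    ((hg.integrable h0 h1).const_mul q), intervalIntegral.integral_const_mul,
    intervalIntegral.integral_const_mul]

/-- On `[0, x]` the chord from `(0, 1)` to `(x, g x)` lies below `g` and above `g x`, where `s ↦ 3
s² - 2 (g x) s` is increasing. So `g` may be replaced by the chord, for which equality holds. -/
theorem quadratic_le_integral_left (hg : IsProfile g) {x : ℝ} (hx : x ∈ Icc (0 : ℝ) 1) :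
    x ≤ ∫ u in (0 : ℝ)..x, (3 * g u ^ 2 + (-2 * g x) * g u) := by
  have h0 : (0 : ℝ) ∈ Icc (0 : ℝ) 1 := by simp
  have hy0 := hg.nonneg x hx
  have hy1 := hg.le_one x hx
  refine le_trans (le_of_eq ?_) (quadratic_le_integral (α := 3 - 2 * g x)
    (β := -(1 - g x) * (6 - 2 * g x)) (γ := 3 * (1 - g x) ^ 2) hx.1
    (hg.integrable_quadratic _ _ h0 hx) ?_)
  · ring
  intro t ht
  rcases hx.1.eq_or_lt with rfl | hx0
  · simp [hg.zero]
  have h := hg.concave.chord_le h0 hx (z := 0 + (x - 0) * t) (by nlinarith [ht.1])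
    (by nlinarith [ht.2])
  set G := g (0 + (x - 0) * t)
  rw [hg.zero] at h
  have hG : 1 - (1 - g x) * t ≤ G := by
    by_contra! hlt
    nlinarith
  have : g x ≤ 1 - (1 - g x) * t := by nlinarith [ht.2]
  nlinarith [mul_nonneg (sub_nonneg.2 hG)
    (show 0 ≤ 3 * (G + (1 - (1 - g x) * t)) - 2 * g x by linarith)]

/-- With `y = g x`, linearize the convex integrand at `y (1 - t)`: `g` then has coefficient `2 y (2
- 3 t)`. By concavity, `g` minus its secant through `t = 0` and `t = 2/3` changes sign together with
this weight, so the secant may replace `g`. Its slope drops out because `∫ t (2 - 3 t) = 0` over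
`[0, 1]`. -/
theorem quadratic_le_integral_right (hg : IsProfile g) {x : ℝ} (hx : x ∈ Icc (0 : ℝ) 1) :
    0 ≤ ∫ u in x..1, (3 * g u ^ 2 + (-2 * g x) * g u) := by
  have h1 : (1 : ℝ) ∈ Icc (0 : ℝ) 1 := by simp
  have hy0 := hg.nonneg x hx
  rcases hx.2.eq_or_lt with rfl | hx1
  · simp
  have hz : x + (1 - x) * (2 / 3) ∈ Icc (0 : ℝ) 1 := ⟨by linarith [hx.1], by linarith⟩
  set y := g x with hy
  set w := g (x + (1 - x) * (2 / 3)) with hw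
  set m := (w - y) * (3 / 2) with hm
  -- the line `y + m t` agrees with `g` at `t = 0` and `t = 2 / 3`
  refine le_trans (le_of_eq ?_) (quadratic_le_integral (α := 4 * y * y - 3 * y ^ 2)
    (β := 2 * y * (-3 * y + 2 * m) + 6 * y ^ 2) (γ := -6 * y * m - 3 * y ^ 2) hx.2
    (hg.integrable_quadratic _ _ hx h1) ?_)
  · ring
  intro t ht
  have hp : x + (1 - x) * t ∈ Icc (0 : ℝ) 1 := ⟨by nlinarith [hx.1, ht.1], by nlinarith [ht.2]⟩
  set G := g (x + (1 - x) * t) with hG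
  have hsign : 0 ≤ (G - (y + m * t)) * (2 - 3 * t) := by
    rcases le_total t (2 / 3) with h | h
    · have := hg.concave.chord_le hx hz (z := x + (1 - x) * t) (by nlinarith [ht.1]) (by nlinarith)
      rw [← hw, ← hy, ← hG] at this
      have h2 : y + m * t ≤ G := by
        refine le_of_mul_le_mul_left ?_ (sub_pos.2 hx1)
        linear_combination (3 / 2) * this + (1 - x) * t * hm
      exact mul_nonneg (by linarith) (by linarith)
    · have := hg.concave.chord_le hx hp (z := x + (1 - x) * (2 / 3)) (by nlinarith [ht.1])
        (by nlinarith)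
      rw [← hw, ← hy, ← hG] at this
      have h2 : G ≤ y + m * t := by
        refine le_of_mul_le_mul_left ?_ (sub_pos.2 hx1)
        linear_combination (3 / 2) * this - (1 - x) * t * hm
      exact mul_nonneg_of_nonpos_of_nonpos (by linarith) (by linarith)
  nlinarith [mul_nonneg hy0 hsign, sq_nonneg (G - y * (1 - t))]

theorem add_mul_le_integral_sq (hg : IsProfile g) {x : ℝ} (hx : x ∈ Icc (0 : ℝ) 1) :
    x + 2 * (∫ u in (0 : ℝ)..1, g u) * g x ≤ 3 * ∫ u in (0 : ℝ)..1, g u ^ 2 := by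
  have h0 : (0 : ℝ) ∈ Icc (0 : ℝ) 1 := by simp
  have h1 : (1 : ℝ) ∈ Icc (0 : ℝ) 1 := by simp
  have h := hg.integral_quadratic 3 (-2 * g x)
  rw [← intervalIntegral.integral_add_adjacent_intervals (hg.integrable_quadratic _ _ h0 hx)
    (hg.integrable_quadratic _ _ hx h1)] at h
  linarith [hg.quadratic_le_integral_left hx, hg.quadratic_le_integral_right hx]

end IsProfile

/-! ### The second linear inequality -/

namespace IsProfile

variable {g : ℝ → ℝ}

theorem exists_eq (hg : IsProfile g) {x y : ℝ} (hx : x ∈ Ico (0 : ℝ) 1) (h1 : g x < y)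
    (h2 : y < 1) : ∃ z, 0 < z ∧ z < x ∧ g z = y := by
  have hxI : x ∈ Icc (0 : ℝ) 1 := ⟨hx.1, hx.2.le⟩
  have h3 := hg.one_sub_le hxI
  -- Starting at `1 - y > 0`, where `g ≥ y` already, keeps the interval in the interior, where
  -- concavity gives continuity.
  have hle : 1 - y ≤ x := by linarith
  have hcont : ContinuousOn g (Icc (1 - y) x) := by
    refine hg.concave.continuousOn_interior.mono ?_
    rw [interior_Icc]
    exact fun u hu => ⟨by linarith [hu.1], hu.2.trans_lt hx.2⟩
  have h4 := hg.one_sub_le (x := 1 - y) ⟨by linarith, by linarith [hx.2]⟩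
  obtain ⟨z, hz, hzy⟩ := intermediate_value_Icc' hle hcont ⟨h1.le, by linarith⟩
  refine ⟨z, by linarith [hz.1], lt_of_le_of_ne hz.2 ?_, hzy⟩
  rintro rfl
  exact h1.ne hzy

/-- Both `g` and the segment `y (1 - t)`, `y = g x`, stay at most `y`, hence below the vertex `(2 +
y) / 3` of the concave integrand. There the integrand increases, so the lower bound by the segment
suffices. -/
theorem concave_quadratic_le_integral_right (hg : IsProfile g) {x : ℝ} (hx : x ∈ Icc (0 : ℝ) 1) :
    2 * g x * (1 - x) ≤ ∫ u in x..1, (-3 * g u ^ 2 + (4 + 2 * g x) * g u) := by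
  have h1 : (1 : ℝ) ∈ Icc (0 : ℝ) 1 := by simp
  have hy0 := hg.nonneg x hx
  have hy1 := hg.le_one x hx
  refine le_trans (le_of_eq ?_) (quadratic_le_integral (α := -3 * g x ^ 2 + (4 + 2 * g x) * g x)
    (β := 6 * g x ^ 2 - (4 + 2 * g x) * g x) (γ := -3 * g x ^ 2) hx.2
    (hg.integrable_quadratic _ _ hx h1) ?_)
  · ring
  intro t ht
  rcases hx.2.eq_or_lt with rfl | hx1
  · simp only [sub_self, zero_mul, add_zero]
    nlinarith [mul_nonneg hy0 ht.1, mul_nonneg (mul_nonneg hy0 ht.1) (sub_nonneg.2 hy1),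
      mul_nonneg (mul_nonneg hy0 hy0) (mul_nonneg ht.1 (sub_nonneg.2 ht.2))]
  have hp : x + (1 - x) * t ∈ Icc (0 : ℝ) 1 := ⟨by nlinarith [hx.1, ht.1], by nlinarith [ht.2]⟩
  have hxp : x ≤ x + (1 - x) * t := by nlinarith [ht.1]
  have h := hg.concave.chord_le hx h1 hxp hp.2
  have h2 := hg.antitoneOn hx hp hxp
  have h3 := hg.nonneg 1 h1
  set G := g (x + (1 - x) * t)
  set y := g x
  have h4 : y * (1 - t) ≤ G := by
    refine le_of_mul_le_mul_left ?_ (sub_pos.2 hx1)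
    linear_combination h + mul_nonneg (sub_nonneg.2 hx.2) (mul_nonneg ht.1 h3)
  have h5 : y * (1 - t) ≤ y := by nlinarith [ht.1]
  nlinarith [mul_nonneg (sub_nonneg.2 h4)
    (show 0 ≤ 4 + 2 * y - 3 * (G + y * (1 - t)) by linarith)]

/-- The integrand `-3 s² + (4 + 2 y) s`, `y = g x`, peaks at `s = (2 + y) / 3`. A comparison
function that crosses `g` exactly at this level is on the side of `g` away from the peak throughout:
above `g` before the crossing and below it after. It equals `1` up to `z` and is then linear down to
`(x, y)`. -/
theorem concave_quadratic_le_integral_left (hg : IsProfile g) {x : ℝ} (hx : x ∈ Ico (0 : ℝ) 1) :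
    x * (1 + 2 * g x) ≤ ∫ u in (0 : ℝ)..x, (-3 * g u ^ 2 + (4 + 2 * g x) * g u) := by
  have h0 : (0 : ℝ) ∈ Icc (0 : ℝ) 1 := by simp
  have hxI : x ∈ Icc (0 : ℝ) 1 := ⟨hx.1, hx.2.le⟩
  have hy0 := hg.nonneg x hxI
  rcases (hg.le_one x hxI).eq_or_lt with hy1 | hy1
  · refine le_trans (le_of_eq ?_) (quadratic_le_integral (α := 3)
      (β := 0) (γ := 0) hx.1 (hg.integrable_quadratic _ _ h0 hxI) ?_)
    · rw [hy1]; ring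
    intro t ht
    have hp : 0 + (x - 0) * t ∈ Icc (0 : ℝ) x :=
      ⟨by nlinarith [ht.1, hx.1], by nlinarith [ht.2, hx.1]⟩
    have hpI : 0 + (x - 0) * t ∈ Icc (0 : ℝ) 1 := ⟨hp.1, hp.2.trans hxI.2⟩
    have h1 := hg.antitoneOn hpI hxI hp.2
    have h2 := hg.le_one _ hpI
    have : g (0 + (x - 0) * t) = 1 := by linarith
    rw [this, hy1]; norm_num
  set y := g x with hy
  obtain ⟨c, hc0, hcx, hc⟩ := hg.exists_eq (y := (2 + y) / 3) hx (by linarith) (by linarith)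
  have hcI : c ∈ Icc (0 : ℝ) 1 := ⟨hc0.le, by linarith [hx.2]⟩
  -- The chord from `(0, 1)` to `(x, y)` reaches the level `(2 + y) / 3` at `x / 3`, and `g` is
  -- above it; this makes `z ≥ 0`.
  have h3c : x ≤ 3 * c := by
    have := hg.concave.chord_le h0 hxI hc0.le hcx.le
    rw [hg.zero, hc, ← hy] at this
    by_contra! hlt
    nlinarith
  -- Chosen so that the line from `(z, 1)` to `(x, y)` passes through `(c, (2 + y) / 3)`, at
  -- parameter `t = 1/3`.
  set z := (3 * c - x) / 2 with hz
  have hz0 : 0 ≤ z := by linarith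
  have hzc : z < c := by linarith
  have hzI : z ∈ Icc (0 : ℝ) 1 := ⟨hz0, by linarith [hcI.2]⟩
  have hleft : z * (1 + 2 * y) ≤ ∫ u in (0 : ℝ)..z, (-3 * g u ^ 2 + (4 + 2 * y) * g u) := by
    refine le_trans (le_of_eq ?_) (quadratic_le_integral (α := 1 + 2 * y)
      (β := 0) (γ := 0) hz0 (hg.integrable_quadratic _ _ h0 hzI) ?_)
    · ring
    intro t ht
    have hp : 0 + (z - 0) * t ∈ Icc (0 : ℝ) z := ⟨by nlinarith [ht.1], by nlinarith [ht.2]⟩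
    have hpI : 0 + (z - 0) * t ∈ Icc (0 : ℝ) 1 := ⟨hp.1, hp.2.trans hzI.2⟩
    have h1 := hg.antitoneOn hpI hcI (hp.2.trans hzc.le)
    have h2 := hg.le_one _ hpI
    rw [hc] at h1
    nlinarith [mul_nonneg (sub_nonneg.2 h2)
      (show 0 ≤ 3 * g (0 + (z - 0) * t) - 1 - 2 * y by linarith)]
  have hright : (x - z) * (1 + 2 * y) ≤ ∫ u in z..x, (-3 * g u ^ 2 + (4 + 2 * y) * g u) := by
    refine le_trans (le_of_eq ?_) (quadratic_le_integral (α := 1 + 2 * y)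
      (β := 2 * (1 - y) ^ 2) (γ := -3 * (1 - y) ^ 2) (hzc.trans hcx).le
      (hg.integrable_quadratic _ _ hzI hxI) ?_)
    · ring
    intro t ht
    have hzx : 0 < x - z := by linarith
    have hp : z + (x - z) * t ∈ Icc z x := ⟨by nlinarith [ht.1], by nlinarith [ht.2]⟩
    have hpI : z + (x - z) * t ∈ Icc (0 : ℝ) 1 := ⟨hz0.trans hp.1, hp.2.trans hxI.2⟩
    have hcz : c - z = (x - z) / 3 := by linarith
    have hxc : x - c = 2 * (x - z) / 3 := by linarith
    set p := z + (x - z) * t with hpdef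
    suffices h : 0 ≤ (g p - (1 - (1 - y) * t)) * (4 + 2 * y - 3 * (g p + (1 - (1 - y) * t))) by
      nlinarith
    rcases le_total p c with hpc | hpc
    · have h1 := hg.antitoneOn hpI hcI hpc
      have h2 := hg.concave.chord_le hpI hxI hpc hcx.le
      rw [hc] at h1 h2
      have h3 : g p ≤ 1 - (1 - y) * t := by
        refine le_of_mul_le_mul_left ?_ hzx
        rw [hxc, ← hy] at h2
        have e1 : x - p = (x - z) * (1 - t) := by rw [hpdef]; ring
        have e2 : c - p = (x - z) * (1 / 3 - t) := by rw [hpdef]; linear_combination hcz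
        rw [e1, e2] at h2
        linear_combination (3 / 2) * h2
      exact mul_nonneg_of_nonpos_of_nonpos (by linarith) (by linarith)
    · have h1 := hg.antitoneOn hcI hpI hpc
      have h2 := hg.concave.chord_le hcI hxI hpc hp.2
      rw [hc] at h1 h2
      have h3 : 1 - (1 - y) * t ≤ g p := by
        refine le_of_mul_le_mul_left ?_ hzx
        rw [hxc, ← hy] at h2
        have e1 : x - p = (x - z) * (1 - t) := by rw [hpdef]; ring
        have e2 : p - c = (x - z) * (t - 1 / 3) := by rw [hpdef]; linear_combination -hcz
        rw [e1, e2] at h2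
        linear_combination (3 / 2) * h2
      exact mul_nonneg (by linarith) (by linarith)
  rw [← intervalIntegral.integral_add_adjacent_intervals (hg.integrable_quadratic _ _ h0 hzI)
    (hg.integrable_quadratic _ _ hzI hxI)]
  linarith

theorem integral_mem_Icc (hg : IsProfile g) : ∫ u in (0 : ℝ)..1, g u ∈ Icc (1 / 2 : ℝ) 1 := by
  have h0 : (0 : ℝ) ∈ Icc (0 : ℝ) 1 := by simp
  have h1 : (1 : ℝ) ∈ Icc (0 : ℝ) 1 := by simp
  constructor
  · have := quadratic_le_integral (φ := g) (α := 1) (β := -1) (γ := 0) zero_le_one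
      (hg.integrable h0 h1) (fun t ht => by
        have := hg.one_sub_le ht
        simp only [sub_zero, zero_add, one_mul]
        linarith)
    linarith
  · have := intervalIntegral.integral_mono_on zero_le_one (hg.integrable h0 h1)
      (intervalIntegrable_const (c := (1 : ℝ))) (fun x hx => hg.le_one x hx)
    simpa using this

theorem add_mul_le_integral_sub (hg : IsProfile g) {x : ℝ} (hx : x ∈ Icc (0 : ℝ) 1) :
    x + (2 - 2 * ∫ u in (0 : ℝ)..1, g u) * g x
      ≤ 4 * (∫ u in (0 : ℝ)..1, g u) - 3 * ∫ u in (0 : ℝ)..1, g u ^ 2 := by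
  have h0 : (0 : ℝ) ∈ Icc (0 : ℝ) 1 := by simp
  have h1 : (1 : ℝ) ∈ Icc (0 : ℝ) 1 := by simp
  have key : ∀ x ∈ Ico (0 : ℝ) 1, x + (2 - 2 * ∫ u in (0 : ℝ)..1, g u) * g x
      ≤ 4 * (∫ u in (0 : ℝ)..1, g u) - 3 * ∫ u in (0 : ℝ)..1, g u ^ 2 := by
    intro x hx
    have hxI : x ∈ Icc (0 : ℝ) 1 := ⟨hx.1, hx.2.le⟩
    have h := hg.integral_quadratic (-3) (4 + 2 * g x)
    rw [← intervalIntegral.integral_add_adjacent_intervals (hg.integrable_quadratic _ _ h0 hxI)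
      (hg.integrable_quadratic _ _ hxI h1)] at h
    linarith [hg.concave_quadratic_le_integral_left hx, hg.concave_quadratic_le_integral_right hxI]
  rcases hx.2.eq_or_lt with rfl | hx1
  -- `g` may jump down at `1`, so the endpoint is reached by approximation from the left, using
  -- monotonicity.
  · refine le_of_forall_pos_lt_add fun ε hε => ?_
    have hd : (0 : ℝ) < min ε 1 := lt_min hε one_pos
    have hw : 1 - min ε 1 / 2 ∈ Ico (0 : ℝ) 1 := ⟨by linarith [min_le_right ε 1], by linarith⟩
    have h := key _ hw
    have h2 := hg.antitoneOn ⟨hw.1, hw.2.le⟩ h1 hw.2.le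
    have h3 := mul_le_mul_of_nonneg_left h2
      (show 0 ≤ 2 - 2 * ∫ u in (0 : ℝ)..1, g u by linarith [hg.integral_mem_Icc.2])
    linarith [min_le_left ε 1]
  · exact key x ⟨hx.1, hx1⟩

theorem sq_integral_le (hg : IsProfile g) :
    (∫ u in (0 : ℝ)..1, g u) ^ 2 ≤ ∫ u in (0 : ℝ)..1, g u ^ 2 := by
  have h0 : (0 : ℝ) ∈ Icc (0 : ℝ) 1 := by simp
  have h1 : (1 : ℝ) ∈ Icc (0 : ℝ) 1 := by simp
  have h := hg.integral_quadratic 1 (-2 * ∫ u in (0 : ℝ)..1, g u)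
  have h2 := quadratic_le_integral (α := -(∫ u in (0 : ℝ)..1, g u) ^ 2) (β := 0) (γ := 0)
    zero_le_one (hg.integrable_quadratic 1 (-2 * ∫ u in (0 : ℝ)..1, g u) h0 h1)
    (fun t _ => by nlinarith [sq_nonneg (g (0 + (1 - 0) * t) - ∫ u in (0 : ℝ)..1, g u)])
  rw [h] at h2
  nlinarith

end IsProfile

/-! ### The algebraic inequality in `A` and `F` -/

theorem cubic_pos {s k : ℝ} (hs0 : 0 < s) (hs1 : s < 1) (hk0 : 0 ≤ k) (hks : k ≤ s)
    (hk : (3 * s - 1) * (s + 1) / 4 ≤ k) :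
    0 < s * (1 + s) * (1 - s) ^ 2 + (2 * (1 + s) * (1 - s) ^ 2 - 4 * s ^ 2) * k
      + (3 * (1 + s) + (1 - s) ^ 2) * k ^ 2 - 2 * k ^ 3 := by
  -- compare with the tangent line in `k` at `k = s ^ 2`
  have hd : 0 < 2 * ((1 - s) * (1 + 2 * s ^ 3) + s ^ 2) := by
    have : 0 < (1 - s) * (1 + 2 * s ^ 3) := mul_pos (by linarith) (by positivity)
    positivity
  have hrem : 0 ≤ (k - s ^ 2) ^ 2 * (4 + s - 3 * s ^ 2 - 2 * k) :=
    mul_nonneg (sq_nonneg _) (by nlinarith)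
  have htan : 0 < s * (1 - s) * ((1 - s ^ 2) * (1 + 2 * s) + s ^ 4)
      + 2 * ((1 - s) * (1 + 2 * s ^ 3) + s ^ 2) * (k - s ^ 2) := by
    -- The tangent line is increasing in `k`, so it is tested at the least admissible `k`: `0` for
    -- `s ≤ 1/3`, and `(3 s - 1) (s + 1) / 4` otherwise.
    rcases le_total s (1 / 3) with h | h
    · have h1 := mul_nonneg hd.le hk0
      have h2 : 0 < (1 - s) * ((1 - s ^ 2) * (1 + 2 * s) + s ^ 4)
          - 2 * s * ((1 - s) * (1 + 2 * s ^ 3) + s ^ 2) := by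
        have e1 : s ^ 2 ≤ 1 / 9 := by nlinarith
        have e2 : s ^ 3 ≤ 1 / 27 := by nlinarith [sq_nonneg s]
        have e3 : 0 ≤ s ^ 4 := by positivity
        have e4 : (8 : ℝ) / 9 * 1 ≤ (1 - s ^ 2) * (1 + 2 * s) := by nlinarith
        have e5 : (1 - s) * (1 + 2 * s ^ 3) + s ^ 2 ≤ 29 / 27 - s + 1 / 9 := by
          nlinarith [mul_nonneg (sub_nonneg.2 hs1.le) (sub_nonneg.2 e2)]
        nlinarith [mul_nonneg (sub_nonneg.2 hs1.le) (sub_nonneg.2 e4),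
          mul_nonneg (sub_nonneg.2 hs1.le) e3, mul_nonneg hs0.le (sub_nonneg.2 e5)]
      nlinarith [mul_pos hs0 h2]
    · have h1 := mul_nonneg hd.le (sub_nonneg.2 hk)
      have h2 : 0 < s * ((1 - s ^ 2) * (1 + 2 * s) + s ^ 4)
          - (1 - s) * ((1 - s) * (1 + 2 * s ^ 3) + s ^ 2) / 2 := by
        have e1 : 0 < s ^ 2 * (1 - s) := mul_pos (by positivity) (by linarith)
        have e2 : 0 ≤ s * (1 - s ^ 2) := mul_nonneg hs0.le (by nlinarith)
        nlinarith
      nlinarith [mul_pos (sub_pos.2 hs1) h2]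
  nlinarith

/-- With `A = (1 + s) / 2` and `3 F = 1 + s + k`, the excess over `3` is the cubic of `cubic_pos`
over a positive denominator. The hypotheses become `0 ≤ k ≤ s`, plus the lower bound on `k` coming
from `A² ≤ F`. -/
theorem vertex_inequality {A F : ℝ} (hA : A ∈ Icc (1 / 2 : ℝ) 1) (hF : 2 * A ≤ 3 * F)
    (hF2 : A ^ 2 ≤ F) (hF1 : 3 * F ≤ 4 * A - 1) {x₁ y₁ x₂ y₂ : ℝ}
    (hx₁ : x₁ = 1 / (4 * A - 3 * F)) (hy₁ : y₁ = (2 - 2 * A) / (4 * A - 3 * F))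
    (hx₂ : x₂ = 1 / (3 * F)) (hy₂ : y₂ = 2 * A / (3 * F)) :
    3 ≤ 3 * F * (x₂ * (1 + y₂ + y₂ ^ 2) + (x₁ - x₂) * (y₂ ^ 2 + y₂ * y₁ + y₁ ^ 2)
        + (1 - x₁) * y₁ ^ 2) ∧
      (3 * F * (x₂ * (1 + y₂ + y₂ ^ 2) + (x₁ - x₂) * (y₂ ^ 2 + y₂ * y₁ + y₁ ^ 2)
        + (1 - x₁) * y₁ ^ 2) = 3 → A = 1 / 2 ∨ A = 1) := by
  obtain ⟨s, rfl⟩ : ∃ s, A = (1 + s) / 2 := ⟨2 * A - 1, by ring⟩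
  obtain ⟨k, rfl⟩ : ∃ k, F = (1 + s + k) / 3 := ⟨3 * F - 1 - s, by ring⟩
  have hs0 : 0 ≤ s := by linarith [hA.1]
  have hs1 : s ≤ 1 := by linarith [hA.2]
  have hk0 : 0 ≤ k := by linarith
  have hks : k ≤ s := by linarith
  have hk : (3 * s - 1) * (s + 1) / 4 ≤ k := by nlinarith
  have hq₁ : 0 < 1 + s - k := by linarith
  have hq₂ : 0 < 1 + s + k := by linarith
  have e₁ : 4 * ((1 + s) / 2) - 3 * ((1 + s + k) / 3) = 1 + s - k := by ring
  have e₂ : 3 * ((1 + s + k) / 3) = 1 + s + k := by ring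
  rw [e₁] at hx₁ hy₁
  rw [e₂] at hx₂ hy₂ ⊢
  have key : (1 + s + k) * (x₂ * (1 + y₂ + y₂ ^ 2) + (x₁ - x₂) * (y₂ ^ 2 + y₂ * y₁ + y₁ ^ 2)
        + (1 - x₁) * y₁ ^ 2) = 3 + (s * (1 + s) * (1 - s) ^ 2
      + (2 * (1 + s) * (1 - s) ^ 2 - 4 * s ^ 2) * k
      + (3 * (1 + s) + (1 - s) ^ 2) * k ^ 2 - 2 * k ^ 3) / ((1 + s - k) ^ 2 * (1 + s + k)) := by
    rw [hx₁, hx₂, hy₁, hy₂]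
    field_simp
    ring
  rw [key]
  rcases hs0.eq_or_lt with rfl | hs0'
  · obtain rfl : k = 0 := le_antisymm hks hk0
    norm_num
  rcases hs1.eq_or_lt with rfl | hs1'
  · obtain rfl : k = 1 := le_antisymm hks (by linarith)
    norm_num
  have h := div_pos (cubic_pos hs0' hs1' hk0 hks hk)
    (show 0 < (1 + s - k) ^ 2 * (1 + s + k) by positivity)
  exact ⟨by linarith, fun h' => absurd h' (by linarith)⟩

/-! ### Dual profiles and the polygonal lower bound -/

theorem linear_sq_le_integral {k : ℝ → ℝ} {u v α β : ℝ} (huv : u ≤ v) (hα : 0 ≤ α) (hβ : 0 ≤ β)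
    (hk : IntervalIntegrable (fun x => k x ^ 2) MeasureTheory.volume u v)
    (h : ∀ t ∈ Icc (0 : ℝ) 1, (1 - t) * α + t * β ≤ k (u + (v - u) * t)) :
    (v - u) * (α ^ 2 + α * β + β ^ 2) ≤ 3 * ∫ x in u..v, k x ^ 2 := by
  have := quadratic_le_integral (α := α ^ 2) (β := 2 * α * (β - α)) (γ := (β - α) ^ 2) huv hk
    (fun t ht => by
      have h1 : 0 ≤ (1 - t) * α + t * β :=
        add_nonneg (mul_nonneg (sub_nonneg.2 ht.2) hα) (mul_nonneg ht.1 hβ)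
      refine le_trans (le_of_eq ?_) (pow_le_pow_left₀ h1 (h t ht) 2)
      ring)
  linarith

/-- `k u` is the largest `y` with `y * g x ≤ 1 - u * x` for all `x ∈ [0, 1]`. -/
def IsDualProfile (g k : ℝ → ℝ) : Prop :=
  ∀ u ∈ Icc (0 : ℝ) 1, ∀ y, y ≤ k u ↔ ∀ x ∈ Icc (0 : ℝ) 1, y * g x ≤ 1 - u * x

namespace IsDualProfile

variable {g k : ℝ → ℝ}

theorem nonneg (hk : IsDualProfile g k) {u : ℝ} (hu : u ∈ Icc (0 : ℝ) 1) : 0 ≤ k u :=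
  (hk u hu 0).2 fun x hx => by nlinarith [hx.1, hx.2, hu.1, hu.2]

theorem antitoneOn (hk : IsDualProfile g k) : AntitoneOn k (Icc 0 1) := by
  intro u hu v hv huv
  refine (hk u hu _).2 fun x hx => ((hk v hv _).1 le_rfl x hx).trans ?_
  nlinarith [hx.1]

theorem integrable_sq (hk : IsDualProfile g k) {u v : ℝ} (hu : u ∈ Icc (0 : ℝ) 1)
    (hv : v ∈ Icc (0 : ℝ) 1) :
    IntervalIntegrable (fun x => k x ^ 2) MeasureTheory.volume u v := by
  apply AntitoneOn.intervalIntegrable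
  intro x hx y hy hxy
  have hx' := uIcc_subset_Icc hu hv hx
  have hy' := uIcc_subset_Icc hu hv hy
  exact pow_le_pow_left₀ (hk.nonneg hy') (hk.antitoneOn hx' hy' hxy) 2

/-- Concavity of `k`: the constraints defining it are jointly affine in `(u, y)`, so they survive
convex combinations. -/
theorem combo_le (hk : IsDualProfile g k) {u v α β t : ℝ} (hu : u ∈ Icc (0 : ℝ) 1)
    (hv : v ∈ Icc (0 : ℝ) 1) (hα : α ≤ k u) (hβ : β ≤ k v) (ht : t ∈ Icc (0 : ℝ) 1) :
    (1 - t) * α + t * β ≤ k (u + (v - u) * t) := by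
  have hp : u + (v - u) * t ∈ Icc (0 : ℝ) 1 :=
    ⟨by nlinarith [ht.1, ht.2, hu.1, hv.1], by nlinarith [ht.1, ht.2, hu.2, hv.2]⟩
  refine (hk _ hp _).2 fun x hx => ?_
  nlinarith [mul_le_mul_of_nonneg_left ((hk u hu α).1 hα x hx) (sub_nonneg.2 ht.2),
    mul_le_mul_of_nonneg_left ((hk v hv β).1 hβ x hx) ht.1]

theorem segment_le_integral (hk : IsDualProfile g k) {u v α β : ℝ} (hu : u ∈ Icc (0 : ℝ) 1)
    (hv : v ∈ Icc (0 : ℝ) 1) (huv : u ≤ v) (hα0 : 0 ≤ α) (hβ0 : 0 ≤ β) (hα : α ≤ k u)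
    (hβ : β ≤ k v) :
    (v - u) * (α ^ 2 + α * β + β ^ 2) ≤ 3 * ∫ x in u..v, k x ^ 2 :=
  linear_sq_le_integral huv hα0 hβ0 (hk.integrable_sq hu hv)
    fun _ ht => hk.combo_le hu hv hα hβ ht

theorem one_third_le_mul_integral (hk : IsDualProfile g k) (hg : IsProfile g) :
    1 / 3 ≤ (∫ x in (0 : ℝ)..1, g x ^ 2) * ∫ u in (0 : ℝ)..1, k u ^ 2 ∧
      ((∫ x in (0 : ℝ)..1, g x ^ 2) * (∫ u in (0 : ℝ)..1, k u ^ 2) = 1 / 3 →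
        (∫ x in (0 : ℝ)..1, g x) = 1 / 2 ∨ (∫ x in (0 : ℝ)..1, g x) = 1) := by
  have h0 : (0 : ℝ) ∈ Icc (0 : ℝ) 1 := by simp
  have h1 : (1 : ℝ) ∈ Icc (0 : ℝ) 1 := by simp
  have hA := hg.integral_mem_Icc
  have hF2 := hg.sq_integral_le
  have hF := hg.add_mul_le_integral_sq h0
  have hF1 := hg.add_mul_le_integral_sub h1
  have hL1 := fun x (hx : x ∈ Icc (0 : ℝ) 1) => hg.add_mul_le_integral_sq hx
  have hL2 := fun x (hx : x ∈ Icc (0 : ℝ) 1) => hg.add_mul_le_integral_sub hx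
  rw [hg.zero, mul_one, zero_add] at hF
  set A := ∫ x in (0 : ℝ)..1, g x
  set F := ∫ x in (0 : ℝ)..1, g x ^ 2
  have hg1 := hg.nonneg 1 h1
  have hF1' : 3 * F ≤ 4 * A - 1 := by nlinarith [hA.2]
  have hq₁ : 1 ≤ 4 * A - 3 * F := by linarith
  have hq₂ : 1 ≤ 3 * F := by linarith [hA.1]
  have hq : 4 * A - 3 * F ≤ 3 * F := by linarith
  obtain ⟨hle, heq⟩ := vertex_inequality hA hF hF2 hF1' rfl rfl rfl rfl
  set x₁ := 1 / (4 * A - 3 * F) with hx₁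
  set y₁ := (2 - 2 * A) / (4 * A - 3 * F) with hy₁
  set x₂ := 1 / (3 * F) with hx₂
  set y₂ := 2 * A / (3 * F) with hy₂
  have hx₂₁ : x₂ ≤ x₁ := one_div_le_one_div_of_le (by linarith) hq
  have hI₁ : x₁ ∈ Icc (0 : ℝ) 1 := ⟨by positivity, (div_le_one (by linarith)).2 hq₁⟩
  have hI₂ : x₂ ∈ Icc (0 : ℝ) 1 := ⟨by positivity, hx₂₁.trans hI₁.2⟩
  have hy₁0 : 0 ≤ y₁ := div_nonneg (by linarith [hA.2]) (by linarith)
  have hy₂0 : 0 ≤ y₂ := div_nonneg (by linarith [hA.1]) (by linarith)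
  have hk0 : 1 ≤ k 0 := (hk 0 h0 1).2 fun x hx => by linarith [hg.le_one x hx]
  have hk₁ : y₁ ≤ k x₁ := by
    refine (hk x₁ hI₁ y₁).2 fun x hx => ?_
    have := hL2 x hx
    rw [hx₁, hy₁, div_mul_eq_mul_div, div_mul_eq_mul_div, le_sub_iff_add_le, ← add_div,
      div_le_one (by linarith)]
    linarith
  have hk₂ : y₂ ≤ k x₂ := by
    refine (hk x₂ hI₂ y₂).2 fun x hx => ?_
    have := hL1 x hx
    rw [hx₂, hy₂, div_mul_eq_mul_div, div_mul_eq_mul_div, le_sub_iff_add_le, ← add_div,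
      div_le_one (by linarith)]
    linarith
  have s₁ := hk.segment_le_integral h0 hI₂ hI₂.1 zero_le_one hy₂0 hk0 hk₂
  have s₂ := hk.segment_le_integral hI₂ hI₁ hx₂₁ hy₂0 hy₁0 hk₂ hk₁
  have s₃ := hk.segment_le_integral hI₁ h1 hI₁.2 hy₁0 le_rfl hk₁ (hk.nonneg h1)
  have hsum : ∫ u in (0 : ℝ)..1, k u ^ 2 = (∫ u in (0 : ℝ)..x₂, k u ^ 2)
      + (∫ u in x₂..x₁, k u ^ 2) + ∫ u in x₁..1, k u ^ 2 := by
    rw [intervalIntegral.integral_add_adjacent_intervals (hk.integrable_sq h0 hI₂)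
      (hk.integrable_sq hI₂ hI₁), intervalIntegral.integral_add_adjacent_intervals
      (hk.integrable_sq h0 hI₁) (hk.integrable_sq hI₁ h1)]
  set K := ∫ u in (0 : ℝ)..1, k u ^ 2
  have hS : x₂ * (1 + y₂ + y₂ ^ 2) + (x₁ - x₂) * (y₂ ^ 2 + y₂ * y₁ + y₁ ^ 2)
      + (1 - x₁) * y₁ ^ 2 ≤ 3 * K := by
    rw [hsum]; linarith
  have hFS := mul_le_mul_of_nonneg_left hS (show 0 ≤ 3 * F by linarith)
  refine ⟨by linarith, fun h => heq (le_antisymm (by linarith) hle)⟩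

end IsDualProfile

/-! ### Profiles with extreme integral -/

namespace IsProfile

variable {g : ℝ → ℝ}

/-- Monotonicity gives `∫ g ≤ x + (1 - x) g x`, which is below `1` if `g x < 1`. The value at `1`
remains free. -/
theorem eq_one_of_integral_eq_one (hg : IsProfile g) (h : ∫ x in (0 : ℝ)..1, g x = 1) {x : ℝ}
    (hx : x ∈ Ico (0 : ℝ) 1) : g x = 1 := by
  have h0 : (0 : ℝ) ∈ Icc (0 : ℝ) 1 := by simp
  have h1 : (1 : ℝ) ∈ Icc (0 : ℝ) 1 := by simp
  have hxI : x ∈ Icc (0 : ℝ) 1 := ⟨hx.1, hx.2.le⟩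
  refine le_antisymm (hg.le_one x hxI) ?_
  rw [← intervalIntegral.integral_add_adjacent_intervals (hg.integrable h0 hxI)
    (hg.integrable hxI h1)] at h
  have i1 := intervalIntegral.integral_mono_on hx.1 (hg.integrable h0 hxI)
    (intervalIntegrable_const (c := (1 : ℝ))) fun u hu => hg.le_one u ⟨hu.1, hu.2.trans hxI.2⟩
  have i2 := intervalIntegral.integral_mono_on hxI.2 (hg.integrable hxI h1)
    (intervalIntegrable_const (c := g x)) fun u hu =>
      hg.antitoneOn hxI ⟨hx.1.trans hu.1, hu.2⟩ hu.1
  simp only [intervalIntegral.integral_const, smul_eq_mul, sub_zero, mul_one] at i1 i2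
  by_contra! hlt
  nlinarith [hx.2]

/-- The chords over `[0, x]` and `[x, 1]` give `∫ g ≥ (x + g x) / 2`. -/
theorem eq_one_sub_of_integral_eq_half (hg : IsProfile g) (h : ∫ x in (0 : ℝ)..1, g x = 1 / 2)
    {x : ℝ} (hx : x ∈ Icc (0 : ℝ) 1) : g x = 1 - x := by
  have h0 : (0 : ℝ) ∈ Icc (0 : ℝ) 1 := by simp
  have h1 : (1 : ℝ) ∈ Icc (0 : ℝ) 1 := by simp
  refine le_antisymm ?_ (hg.one_sub_le hx)
  rw [← intervalIntegral.integral_add_adjacent_intervals (hg.integrable h0 hx)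
    (hg.integrable hx h1)] at h
  have chord : ∀ u ∈ Icc (0 : ℝ) 1, ∀ v ∈ Icc (0 : ℝ) 1, u ≤ v →
      (v - u) * (g u + (g v - g u) / 2 + 0 / 3) ≤ ∫ x in u..v, g x := by
    intro u hu v hv huv
    refine quadratic_le_integral huv (hg.integrable hu hv) fun t ht => ?_
    rcases huv.eq_or_lt with rfl | huv'
    · simp
    have := hg.concave.chord_le hu hv (z := u + (v - u) * t) (by nlinarith [ht.1])
      (by nlinarith [ht.2])
    refine le_of_mul_le_mul_left ?_ (sub_pos.2 huv')
    linear_combination this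
  have c1 := chord 0 h0 x hx hx.1
  have c2 := chord x hx 1 h1 hx.2
  rw [hg.zero] at c1
  have hg1 := hg.nonneg 1 h1
  nlinarith [mul_nonneg (sub_nonneg.2 hx.2) hg1]

end IsProfile

/-! ### The dual function, polarity and rescaling -/

section dual

variable {a : ℝ} {f : ℝ → ℝ}

theorem one_sub_mul_nonneg {x x' : ℝ} (ha : 0 < a) (hx : x ∈ Icc (-a) a)
    (hx' : x' ∈ Icc (-(1 / a)) (1 / a)) : 0 ≤ 1 - x' * x := by
  have h1 : |x' * x| ≤ 1 / a * a := by
    rw [abs_mul]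
    exact mul_le_mul (abs_le.2 hx') (abs_le.2 hx) (abs_nonneg _) (by positivity)
  rw [one_div_mul_cancel ha.ne'] at h1
  linarith [le_abs_self (x' * x)]

theorem le_dualFunction_iff (ha : 0 < a) (hnonneg : ∀ x ∈ Icc (-a) a, 0 ≤ f x)
    (hne : ∃ x ∈ Icc (-a) a, f x ≠ 0) {x' y : ℝ} (hx' : x' ∈ Icc (-(1 / a)) (1 / a)) :
    y ≤ dualFunction a f x' ↔ ∀ x ∈ Icc (-a) a, y * f x ≤ 1 - x' * x := by
  have hbdd : BddBelow ((fun x : ℝ => (1 - x' * x) / f x) '' {x : ℝ | x ∈ Icc (-a) a ∧ f x ≠ 0}) := by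
    refine ⟨0, ?_⟩
    rintro _ ⟨x, ⟨hx, -⟩, rfl⟩
    exact div_nonneg (one_sub_mul_nonneg ha hx hx') (hnonneg x hx)
  obtain ⟨x₀, hx₀⟩ := hne
  rw [dualFunction, le_csInf_iff hbdd ⟨_, mem_image_of_mem _ hx₀⟩]
  constructor
  · intro h x hx
    by_cases h0 : f x = 0
    · simpa [h0] using one_sub_mul_nonneg ha hx hx'
    · exact (le_div_iff₀ (lt_of_le_of_ne (hnonneg x hx) (Ne.symm h0))).1
        (h _ (mem_image_of_mem _ ⟨hx, h0⟩))
  · rintro h _ ⟨x, ⟨hx, h0⟩, rfl⟩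
    exact (le_div_iff₀ (lt_of_le_of_ne (hnonneg x hx) (Ne.symm h0))).2 (h x hx)

theorem dualFunction_neg (ha : 0 < a) (heven : ∀ x ∈ Icc (-a) a, f (-x) = f x)
    (hnonneg : ∀ x ∈ Icc (-a) a, 0 ≤ f x) (hne : ∃ x ∈ Icc (-a) a, f x ≠ 0) {x' : ℝ}
    (hx' : x' ∈ Icc (-(1 / a)) (1 / a)) : dualFunction a f (-x') = dualFunction a f x' := by
  have key : ∀ z ∈ Icc (-(1 / a)) (1 / a), dualFunction a f z ≤ dualFunction a f (-z) := by
    intro z hz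
    refine (le_dualFunction_iff ha hnonneg hne ⟨by linarith [hz.2], by linarith [hz.1]⟩).2
      fun x hx => ?_
    have := (le_dualFunction_iff ha hnonneg hne hz).1 le_rfl (-x)
      ⟨by linarith [hx.2], by linarith [hx.1]⟩
    rw [heven x hx] at this
    linarith
  refine le_antisymm ?_ (key x' hx')
  have := key (-x') ⟨by linarith [hx'.2], by linarith [hx'.1]⟩
  rwa [neg_neg] at this

theorem generatingDomain_dualFunction (ha : 0 < a) (hnonneg : ∀ x ∈ Icc (-a) a, 0 ≤ f x)
    (hne : ∃ x ∈ Icc (-a) a, f x ≠ 0) :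
    generatingDomain (1 / a) (dualFunction a f) = polarBody (generatingDomain a f) := by
  have hinner : ∀ p q : EuclideanSpace ℝ (Fin 2), inner ℝ p q = p 0 * q 0 + p 1 * q 1 := by
    intro p q
    simp [PiLp.inner_apply, Fin.sum_univ_two, mul_comm]
  ext p
  constructor
  · rintro ⟨hp0, hp1⟩ q ⟨hq0, hq1⟩
    rw [hinner]
    have h1 := (le_dualFunction_iff ha hnonneg hne hp0).1 hp1 (q 0) hq0
    have h2 : p 1 * q 1 ≤ |p 1| * f (q 0) := by
      refine (le_abs_self _).trans ?_
      rw [abs_mul]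
      exact mul_le_mul_of_nonneg_left hq1 (abs_nonneg _)
    linarith
  · intro h
    have h' : ∀ x ∈ Icc (-a) a, ∀ y, |y| ≤ f x → p 0 * x + p 1 * y ≤ 1 := by
      intro x hx y hy
      have := h !₂[x, y] ⟨by simpa using hx, by simpa using hy⟩
      rw [hinner] at this
      simpa using this
    have hpa := h' a ⟨by linarith, le_rfl⟩ 0 (by simpa using hnonneg a ⟨by linarith, le_rfl⟩)
    have hna := h' (-a) ⟨le_rfl, by linarith⟩ 0
      (by simpa using hnonneg (-a) ⟨le_rfl, by linarith⟩)
    have hp0 : p 0 ∈ Icc (-(1 / a)) (1 / a) := by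
      constructor
      · rw [neg_le, le_div_iff₀ ha]; linarith
      · rw [le_div_iff₀ ha]; linarith
    refine ⟨hp0, (le_dualFunction_iff ha hnonneg hne hp0).2 fun x hx => ?_⟩
    have hfx := hnonneg x hx
    rcases abs_cases (p 1) with ⟨he, -⟩ | ⟨he, -⟩
    · have := h' x hx (f x) (abs_of_nonneg hfx).le
      rw [he]; linarith
    · have := h' x hx (-f x) (by rw [abs_neg, abs_of_nonneg hfx])
      rw [he]; linarith

theorem apply_zero_pos (hconc : ConcaveOn ℝ (Icc (-a) a) f)
    (heven : ∀ x ∈ Icc (-a) a, f (-x) = f x) (hnonneg : ∀ x ∈ Icc (-a) a, 0 ≤ f x)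
    (hne : ∃ x ∈ Icc (-a) a, f x ≠ 0) : 0 < f 0 ∧ ∀ x ∈ Icc (-a) a, f x ≤ f 0 := by
  have hle : ∀ x ∈ Icc (-a) a, f x ≤ f 0 := by
    intro x hx
    have h := hconc.2 hx (show -x ∈ Icc (-a) a from ⟨by linarith [hx.2], by linarith [hx.1]⟩)
      (show (0 : ℝ) ≤ 1 / 2 by norm_num) (show (0 : ℝ) ≤ 1 / 2 by norm_num) (by norm_num)
    rw [heven x hx] at h
    simp only [smul_eq_mul, mul_neg, add_neg_cancel] at h
    linarith
  obtain ⟨x, hx, hx0⟩ := hne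
  exact ⟨(lt_of_le_of_ne (hnonneg x hx) (Ne.symm hx0)).trans_le (hle x hx), hle⟩

theorem isProfile_rescale (ha : 0 < a) (hconc : ConcaveOn ℝ (Icc (-a) a) f)
    (heven : ∀ x ∈ Icc (-a) a, f (-x) = f x) (hnonneg : ∀ x ∈ Icc (-a) a, 0 ≤ f x)
    (hne : ∃ x ∈ Icc (-a) a, f x ≠ 0) : IsProfile fun t => f (a * t) / f 0 := by
  obtain ⟨h0, hle⟩ := apply_zero_pos hconc heven hnonneg hne
  have hmem : ∀ t ∈ Icc (0 : ℝ) 1, a * t ∈ Icc (-a) a :=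
    fun t ht => ⟨by nlinarith [ht.1], by nlinarith [ht.2]⟩
  refine ⟨⟨convex_Icc 0 1, fun x hx y hy p q hp hq hpq => ?_⟩, by simp [h0.ne'],
    fun x hx => div_nonneg (hnonneg _ (hmem x hx)) h0.le,
    fun x hx => (div_le_one h0).2 (hle _ (hmem x hx))⟩
  have h := hconc.2 (hmem x hx) (hmem y hy) hp hq hpq
  simp only [smul_eq_mul] at h ⊢
  rw [show a * (p * x + q * y) = p * (a * x) + q * (a * y) by ring]
  calc _ = (p * f (a * x) + q * f (a * y)) / f 0 := by ring
    _ ≤ _ := div_le_div_of_nonneg_right h h0.le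

theorem isDualProfile_rescale (ha : 0 < a) (hconc : ConcaveOn ℝ (Icc (-a) a) f)
    (heven : ∀ x ∈ Icc (-a) a, f (-x) = f x) (hnonneg : ∀ x ∈ Icc (-a) a, 0 ≤ f x)
    (hne : ∃ x ∈ Icc (-a) a, f x ≠ 0) :
    IsDualProfile (fun t => f (a * t) / f 0) fun u => f 0 * dualFunction a f (1 / a * u) := by
  have h0 := (apply_zero_pos hconc heven hnonneg hne).1
  intro u hu y
  have hu' : 1 / a * u ∈ Icc (-(1 / a)) (1 / a) := by
    have : 0 < 1 / a := by positivity
    exact ⟨by nlinarith [hu.1], by nlinarith [hu.2]⟩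
  rw [← div_le_iff₀' h0, le_dualFunction_iff ha hnonneg hne hu']
  constructor
  · intro h x hx
    have := h (a * x) ⟨by nlinarith [hx.1], by nlinarith [hx.2]⟩
    calc y * (f (a * x) / f 0) = y / f 0 * f (a * x) := by ring
      _ ≤ 1 - 1 / a * u * (a * x) := this
      _ = 1 - u * x := by field_simp
  · intro h
    -- For `u ≥ 0` the constraint at a negative `x` is weaker than the one at `-x`, so `[0, a]`
    -- suffices.
    have key : ∀ x ∈ Icc (0 : ℝ) a, y / f 0 * f x ≤ 1 - 1 / a * u * x := by
      intro x hx
      have := h (x / a) ⟨div_nonneg hx.1 ha.le, (div_le_one ha).2 hx.2⟩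
      simp only [mul_div_cancel₀ _ ha.ne'] at this
      calc y / f 0 * f x = y * (f x / f 0) := by ring
        _ ≤ 1 - u * (x / a) := this
        _ = 1 - 1 / a * u * x := by ring
    intro x hx
    rcases le_total 0 x with hx0 | hx0
    · exact key x ⟨hx0, hx.2⟩
    · have h1 := key (-x) ⟨by linarith, by linarith [hx.1]⟩
      rw [heven x hx] at h1
      have : 0 ≤ 1 / a * u := mul_nonneg (by positivity) hu.1
      nlinarith

end dual

/-! ### Assembly and the equality cases -/

theorem integral_symm_eq_of_even {φ : ℝ → ℝ} {c : ℝ} (hc : 0 < c)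
    (heven : ∀ x ∈ Icc (-c) c, φ (-x) = φ x) (hanti : AntitoneOn (fun t => φ (c * t)) (Icc 0 1)) :
    ∫ x in (-c)..c, φ x = 2 * c * ∫ t in (0 : ℝ)..1, φ (c * t) := by
  have hanti' : AntitoneOn φ (Icc 0 c) := by
    intro x hx y hy hxy
    have := hanti (a := x / c) (b := y / c) ⟨div_nonneg hx.1 hc.le, (div_le_one hc).2 hx.2⟩
      ⟨div_nonneg hy.1 hc.le, (div_le_one hc).2 hy.2⟩ (div_le_div_of_nonneg_right hxy hc.le)
    simpa only [mul_div_cancel₀ _ hc.ne'] using this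
  have hpos : IntervalIntegrable φ MeasureTheory.volume 0 c :=
    AntitoneOn.intervalIntegrable (by rwa [uIcc_of_le hc.le])
  have hneg : IntervalIntegrable φ MeasureTheory.volume (-c) 0 := by
    apply MonotoneOn.intervalIntegrable
    rw [uIcc_of_le (by linarith)]
    intro x hx y hy hxy
    rw [← heven x ⟨hx.1, by linarith [hx.2]⟩, ← heven y ⟨hy.1, by linarith [hy.2]⟩]
    exact hanti' ⟨by linarith [hy.2], by linarith [hy.1]⟩ ⟨by linarith [hx.2], by linarith [hx.1]⟩
      (by linarith)
  have hrefl : ∫ x in (-c)..0, φ x = ∫ x in (0 : ℝ)..c, φ x := by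
    have h := intervalIntegral.integral_comp_neg (a := 0) (b := c) φ
    rw [neg_zero] at h
    rw [← h]
    refine intervalIntegral.integral_congr fun x hx => ?_
    rw [uIcc_of_le hc.le] at hx
    exact heven x ⟨by linarith [hx.1], hx.2⟩
  rw [← intervalIntegral.integral_add_adjacent_intervals hneg hpos, hrefl,
    intervalIntegral.integral_comp_mul_left φ hc.ne', mul_zero, mul_one, smul_eq_mul]
  field_simp
  ring

theorem integral_one_sub_sq : ∫ x in (0 : ℝ)..1, (1 - x) ^ 2 = 1 / 3 := by
  rw [intervalIntegral.integral_comp_sub_left (fun x : ℝ => x ^ 2) 1]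
  norm_num

theorem theorem1p2 (a : ℝ) (ha : 0 < a) (f : ℝ → ℝ)
    (hconc : ConcaveOn ℝ (Icc (-a) a) f)
    (heven : ∀ x ∈ Icc (-a) a, f (-x) = f x)
    (hnonneg : ∀ x ∈ Icc (-a) a, 0 ≤ f x)
    (hne : ∃ x ∈ Icc (-a) a, f x ≠ 0) :
    (4 / 3 : ℝ) ≤
        (∫ x in (-a)..a, f x ^ 2) * (∫ x' in (-(1 / a))..(1 / a), dualFunction a f x' ^ 2) ∧
      ((∫ x in (-a)..a, f x ^ 2) * (∫ x' in (-(1 / a))..(1 / a), dualFunction a f x' ^ 2) = 4 / 3 ↔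
        (∀ x ∈ Ioo (-a) a, f x = f 0) ∨
          (∀ x' ∈ Icc (-(1 / a)) (1 / a), dualFunction a f x' = 1 / f 0)) ∧
      generatingDomain (1 / a) (dualFunction a f) = polarBody (generatingDomain a f) := by
  have hg := isProfile_rescale ha hconc heven hnonneg hne
  have hk := isDualProfile_rescale ha hconc heven hnonneg hne
  have hb := (apply_zero_pos hconc heven hnonneg hne).1
  set b := f 0 with hbdef
  have ha' : 0 < 1 / a := by positivity
  have h0 : (0 : ℝ) ∈ Icc (0 : ℝ) 1 := by simp
  have h1 : (1 : ℝ) ∈ Icc (0 : ℝ) 1 := by simp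
  set g : ℝ → ℝ := fun t => f (a * t) / b with hgdef
  set k : ℝ → ℝ := fun u => b * dualFunction a f (1 / a * u) with hkdef
  have hfg : ∀ t, f (a * t) = b * g t := fun t => by simp only [hgdef]; field_simp
  have hdk : ∀ u, dualFunction a f (1 / a * u) = k u / b := fun u => by simp only [hkdef]; field_simp
  have hf_abs : ∀ x ∈ Icc (-a) a, f x = b * g (|x| / a) := by
    intro x hx
    rw [← hfg, mul_div_cancel₀ _ ha.ne']
    rcases abs_cases x with ⟨h, -⟩ | ⟨h, -⟩
    · rw [h]
    · rw [h, heven x hx]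
  have hd_abs : ∀ x ∈ Icc (-(1 / a)) (1 / a), dualFunction a f x = k (a * |x|) / b := by
    intro x hx
    rw [← hdk, ← mul_assoc, one_div_mul_cancel ha.ne', one_mul]
    rcases abs_cases x with ⟨h, -⟩ | ⟨h, -⟩
    · rw [h]
    · rw [h, dualFunction_neg ha heven hnonneg hne hx]
  have hF : ∫ x in (-a)..a, f x ^ 2 = 2 * a * (b ^ 2 * ∫ t in (0 : ℝ)..1, g t ^ 2) := by
    rw [integral_symm_eq_of_even ha (φ := fun x => f x ^ 2) (fun x hx => by simp only [heven x hx])]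
    · simp only [hfg, mul_pow, intervalIntegral.integral_const_mul]
    · intro x hx y hy hxy
      simp only [hfg, mul_pow]
      exact mul_le_mul_of_nonneg_left
        (pow_le_pow_left₀ (hg.nonneg y hy) (hg.antitoneOn hx hy hxy) 2) (by positivity)
  have hK : ∫ x' in (-(1 / a))..(1 / a), dualFunction a f x' ^ 2
      = 2 * (1 / a) * ((∫ u in (0 : ℝ)..1, k u ^ 2) / b ^ 2) := by
    rw [integral_symm_eq_of_even ha' (φ := fun x => dualFunction a f x ^ 2)
      (fun x hx => by simp only [dualFunction_neg ha heven hnonneg hne hx])]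
    · simp only [hdk, div_pow, intervalIntegral.integral_div]
    · intro x hx y hy hxy
      simp only [hdk, div_pow]
      exact div_le_div_of_nonneg_right
        (pow_le_pow_left₀ (hk.nonneg hy) (hk.antitoneOn hx hy hxy) 2) (by positivity)
  have hprod : (∫ x in (-a)..a, f x ^ 2) *
      (∫ x' in (-(1 / a))..(1 / a), dualFunction a f x' ^ 2)
      = 4 * ((∫ t in (0 : ℝ)..1, g t ^ 2) * ∫ u in (0 : ℝ)..1, k u ^ 2) := by
    rw [hF, hK]; field_simp; ring
  have hcore := hk.one_third_le_mul_integral hg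
  have hlin : (∀ x ∈ Icc (0 : ℝ) 1, g x = 1 - x) → ∀ u ∈ Icc (0 : ℝ) 1, k u = 1 := by
    intro h u hu
    refine le_antisymm ?_ ((hk u hu 1).2 fun x hx => ?_)
    · have := (hk u hu (k u)).1 le_rfl 0 h0
      rw [hg.zero] at this
      linarith
    · rw [h x hx]; nlinarith [hx.1, hu.2]
  rw [hprod]
  refine ⟨by linarith [hcore.1], ⟨fun h => ?_, ?_⟩,
    generatingDomain_dualFunction ha hnonneg hne⟩
  · rcases hcore.2 (by linarith) with hA | hA
    · right
      intro x' hx'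
      rw [hd_abs x' hx', hlin (fun x hx => hg.eq_one_sub_of_integral_eq_half hA hx)]
      refine ⟨by positivity, ?_⟩
      calc a * |x'| ≤ a * (1 / a) := mul_le_mul_of_nonneg_left (abs_le.2 hx') ha.le
        _ = 1 := mul_one_div_cancel ha.ne'
    · left
      intro x hx
      rw [hf_abs x ⟨hx.1.le, hx.2.le⟩, hg.eq_one_of_integral_eq_one hA, mul_one]
      exact ⟨by positivity, (div_lt_one ha).2 (abs_lt.2 hx)⟩
  · rintro (h | h)
    · have hg1 : ∀ x ∈ Ico (0 : ℝ) 1, g x = 1 := by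
        intro x hx
        simp only [hgdef]
        rw [h (a * x) ⟨by nlinarith [hx.1], by nlinarith [hx.2]⟩, div_self hb.ne']
      have hk1 : ∀ u ∈ Icc (0 : ℝ) 1, k u = 1 - u := by
        intro u hu
        refine le_antisymm (le_of_forall_pos_lt_add fun ε hε => ?_)
          ((hk u hu _).2 fun x hx => ?_)
        -- `g 1` is unknown, so the bound `k u ≤ 1 - u` comes from constraints at points tending to
        -- `1`.
        · have hd : (0 : ℝ) < min ε 1 := lt_min hε one_pos
          have hw : 1 - min ε 1 / 2 ∈ Ico (0 : ℝ) 1 := ⟨by linarith [min_le_right ε 1], by linarith⟩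
          have := (hk u hu (k u)).1 le_rfl _ ⟨hw.1, hw.2.le⟩
          rw [hg1 _ hw] at this
          nlinarith [min_le_left ε 1, hu.1, hu.2]
        · nlinarith [hg.le_one x hx, hg.nonneg x hx, hx.1, hx.2, hu.1, hu.2,
            mul_le_mul_of_nonneg_left (hg.le_one x hx) (sub_nonneg.2 hu.2),
            mul_nonneg hu.1 (sub_nonneg.2 hx.2)]
      have e1 : ∫ t in (0 : ℝ)..1, g t ^ 2 = 1 := by
        rw [intervalIntegral.integral_congr_Ioo_of_le zero_le_one (g := fun _ => (1 : ℝ))]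
        · simp
        · intro x hx
          simp only [hg1 x ⟨hx.1.le, hx.2⟩, one_pow]
      have e2 : ∫ u in (0 : ℝ)..1, k u ^ 2 = 1 / 3 := by
        rw [← integral_one_sub_sq]
        refine intervalIntegral.integral_congr fun u hu => ?_
        rw [uIcc_of_le zero_le_one] at hu
        simp only [hk1 u hu]
      rw [e1, e2]; norm_num
    · have hk1 : ∀ u ∈ Icc (0 : ℝ) 1, k u = 1 := by
        intro u hu
        simp only [hkdef]
        rw [h (1 / a * u) ⟨by nlinarith [hu.1], by nlinarith [hu.2]⟩, mul_one_div_cancel hb.ne']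
      have hg1 : ∀ x ∈ Icc (0 : ℝ) 1, g x = 1 - x := by
        intro x hx
        refine le_antisymm ?_ (hg.one_sub_le hx)
        have := (hk 1 h1 (k 1)).1 le_rfl x hx
        rw [hk1 1 h1] at this
        linarith
      have e1 : ∫ t in (0 : ℝ)..1, g t ^ 2 = 1 / 3 := by
        rw [← integral_one_sub_sq]
        refine intervalIntegral.integral_congr fun u hu => ?_
        rw [uIcc_of_le zero_le_one] at hu
        simp only [hg1 u hu]
      have e2 : ∫ u in (0 : ℝ)..1, k u ^ 2 = 1 := by
        rw [intervalIntegral.integral_congr (g := fun _ => (1 : ℝ))]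
        · simp
        · intro u hu
          rw [uIcc_of_le zero_le_one] at hu
          simp only [hk1 u hu, one_pow]
      rw [e1, e2]; norm_num
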